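/- For a topological space $X$, a point $x\in X$ and $n\ge 1$, let $\Omega^n(X,x)$ be the space of continuous maps $[0,1]^n\to X$ sending the boundary $\partial [0,1]^n$ to $x$, with the compact-open topology, and let $\pi_n^{qtop}(X,x)$ be the $n$th homotopy group $\pi_n(X,x)$ endowed with the quotient topology induced by the natural surjection $\Omega^n(X,x)\to\pi_n(X,x)$; it is a quasitopological group, that is, inversion and all left and right translations are continuous. Let $p:\tilde X\to X$ be a covering projection (a continuous map such that every point of $X$ has an open neighbourhood $U$ for which $p^{-1}(U)$ is homeomorphic over $U$ to $U\times D$ for some discrete space $D$), let $\tilde x\in\tilde X$ and $x=p(\tilde x)$, and let $p_*$ denote the homomorphisms $[f]\mapsto[p\circ f]$ induced by $p$. Then: 1. for every $n\ge 2$, $p_*:\pi_n^{qtop}(\tilde X,\tilde x)\to\pi_n^{qtop}(X,x)$ is an isomorphism of quasitopological groups, i.e. a group isomorphism and a homeomorphism; in particular $\pi_n^{qtop}(\tilde X,\tilde x)\cong\pi_n^{qtop}(X,x)$; 2. $p_*:\pi_1^{qtop}(\tilde X,\tilde x)\to\pi_1^{qtop}(X,x)$ is an embedding of quasitopological groups,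 i.e. an injective homomorphism that is a homeomorphism onto its image with the subspace topology. -/

import Mathlib

open scoped Topology Topology.Homotopy unitInterval

/-- The natural surjection `q : Ω^N (X, x) → π_N (X, x)`, sending a loop to its homotopy class. -/
def HomotopyGroup.proj {N X : Type*} [TopologicalSpace X] {x : X} (f : GenLoop N X x) :
    HomotopyGroup N X x :=
  Quotient.mk (GenLoop.Homotopic.setoid N x) f

/-- The quasitopological homotopy group: the homotopy group of `(X, x)` carries the quotient topology
along `q : Ω^N (X, x) → π_N (X, x)`, where the loop space `Ω^N (X, x)` of maps from the cube sending its
boundary to `x` has the compact-open topology. -/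
instance HomotopyGroup.instTopologicalSpaceQTop {N X : Type*} [TopologicalSpace X] (x : X) :
    TopologicalSpace (HomotopyGroup N X x) :=
  TopologicalSpace.coinduced (HomotopyGroup.proj (N := N) (x := x)) inferInstance

theorem HomotopyGroup.proj_surjective {N X : Type*} [TopologicalSpace X] {x : X} :
    Function.Surjective (HomotopyGroup.proj (N := N) (x := x)) :=
  Quotient.exists_rep

theorem HomotopyGroup.isQuotientMap_proj {N X : Type*} [TopologicalSpace X] {x : X} :
    Topology.IsQuotientMap (HomotopyGroup.proj (N := N) (x := x)) :=
  isQuotientMap_quotient_mk'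

theorem HomotopyGroup.proj_mul_proj {N X : Type*} [TopologicalSpace X] {x : X}
    [DecidableEq N] [Nonempty N] (i : N) (f g : GenLoop N X x) :
    HomotopyGroup.proj f * HomotopyGroup.proj g = HomotopyGroup.proj (GenLoop.transAt i g f) :=
  HomotopyGroup.mul_spec (i := i) (p := f) (q := g)

theorem HomotopyGroup.proj_inv {N X : Type*} [TopologicalSpace X] {x : X}
    [DecidableEq N] [Nonempty N] (i : N) (f : GenLoop N X x) :
    (HomotopyGroup.proj f)⁻¹ = HomotopyGroup.proj (GenLoop.symmAt i f) :=
  HomotopyGroup.inv_spec (i := i) (p := f)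

theorem GenLoop.continuous_transAt {N X : Type*} [TopologicalSpace X] {x : X} [DecidableEq N]
    (i : N) : Continuous (fun fg : GenLoop N X x × GenLoop N X x => GenLoop.transAt i fg.1 fg.2) := by
  simp only [← GenLoop.fromLoop_trans_toLoop]
  have h := GenLoop.continuous_toLoop (X := X) (x := x) i
  exact (GenLoop.continuous_fromLoop i).comp
    (Path.continuous_trans.comp ((h.comp continuous_fst).prodMk (h.comp continuous_snd)))

theorem GenLoop.continuous_symmAt {N X : Type*} [TopologicalSpace X] {x : X} [DecidableEq N]
    (i : N) : Continuous (fun f : GenLoop N X x => GenLoop.symmAt i f) := by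
  simp only [← GenLoop.fromLoop_symm_toLoop]
  exact (GenLoop.continuous_fromLoop i).comp
    (Path.continuous_symm.comp (GenLoop.continuous_toLoop i))

theorem HomotopyGroup.continuous_const_mul_qtop {N X : Type*} [TopologicalSpace X] {x : X}
    [DecidableEq N] [Nonempty N] (a : HomotopyGroup N X x) : Continuous fun b => a * b := by
  obtain ⟨f, rfl⟩ := HomotopyGroup.proj_surjective a
  have h : Continuous fun g : GenLoop N X x => (g, f) := by fun_prop
  have h1 := HomotopyGroup.isQuotientMap_proj.continuous.comp
    ((GenLoop.continuous_transAt (Classical.arbitrary N)).comp h)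
  rw [HomotopyGroup.isQuotientMap_proj.continuous_iff]
  refine h1.congr fun g => ?_
  exact (HomotopyGroup.proj_mul_proj (Classical.arbitrary N) f g).symm

theorem HomotopyGroup.continuous_mul_const_qtop {N X : Type*} [TopologicalSpace X] {x : X}
    [DecidableEq N] [Nonempty N] (a : HomotopyGroup N X x) : Continuous fun b => b * a := by
  obtain ⟨f, rfl⟩ := HomotopyGroup.proj_surjective a
  have h : Continuous fun g : GenLoop N X x => (f, g) := by fun_prop
  have h1 := HomotopyGroup.isQuotientMap_proj.continuous.comp
    ((GenLoop.continuous_transAt (Classical.arbitrary N)).comp h)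
  rw [HomotopyGroup.isQuotientMap_proj.continuous_iff]
  refine h1.congr fun g => ?_
  exact (HomotopyGroup.proj_mul_proj (Classical.arbitrary N) g f).symm

/-- All translations of the homotopy group are continuous. Together with the continuity of inversion
below, this says that it is a quasitopological group. -/
instance HomotopyGroup.instSeparatelyContinuousMulQTop {N X : Type*} [TopologicalSpace X] (x : X)
    [DecidableEq N] [Nonempty N] : SeparatelyContinuousMul (HomotopyGroup N X x) where
  continuous_const_mul := HomotopyGroup.continuous_const_mul_qtop _
  continuous_mul_const := HomotopyGroup.continuous_mul_const_qtop _

instance HomotopyGroup.instContinuousInvQTop {N X : Type*} [TopologicalSpace X] (x : X)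
    [DecidableEq N] [Nonempty N] : ContinuousInv (HomotopyGroup N X x) where
  continuous_inv := by
    have h1 := HomotopyGroup.isQuotientMap_proj.continuous.comp
      (GenLoop.continuous_symmAt (X := X) (x := x) (Classical.arbitrary N))
    rw [HomotopyGroup.isQuotientMap_proj.continuous_iff]
    refine h1.congr fun g => ?_
    exact (HomotopyGroup.proj_inv (Classical.arbitrary N) g).symm

/-- Post-composition of a generalized loop with a continuous map `p`. -/
def GenLoop.postcomp {N E X : Type*} [TopologicalSpace E] [TopologicalSpace X] (p : C(E, X)) (e : E)
    (f : GenLoop N E e) : GenLoop N X (p e) :=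
  ⟨p.comp f.1, fun y hy => congrArg p (f.2 y hy)⟩

theorem GenLoop.postcomp_transAt {N E X : Type*} [DecidableEq N] [TopologicalSpace E]
    [TopologicalSpace X] (p : C(E, X)) (e : E) (i : N) (f g : GenLoop N E e) :
    GenLoop.postcomp p e (GenLoop.transAt i f g) =
      GenLoop.transAt i (GenLoop.postcomp p e f) (GenLoop.postcomp p e g) :=
  GenLoop.ext _ _ fun _ => apply_ite p _ _ _

/-- The map `p_*` on homotopy classes, `[f] ↦ [p ∘ f]`. -/
def HomotopyGroup.inducedMap (N : Type*) {E X : Type*}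
    [TopologicalSpace E] [TopologicalSpace X] (p : C(E, X)) (e : E) :
    HomotopyGroup N E e → HomotopyGroup N X (p e) :=
  Quotient.map (GenLoop.postcomp p e) fun _ _ h =>
    ContinuousMap.HomotopicRel.comp_continuousMap h p

/-- The homomorphism `p_* : π_N (E, e) → π_N (X, p e)`, `[f] ↦ [p ∘ f]`. -/
noncomputable def HomotopyGroup.inducedHom (N : Type*) [DecidableEq N] [Nonempty N] {E X : Type*}
    [TopologicalSpace E] [TopologicalSpace X] (p : C(E, X)) (e : E) :
    HomotopyGroup N E e →* HomotopyGroup N X (p e) :=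
  MonoidHom.mk' (HomotopyGroup.inducedMap N p e) (by
    intro a b
    obtain ⟨f, rfl⟩ := HomotopyGroup.proj_surjective a
    obtain ⟨g, rfl⟩ := HomotopyGroup.proj_surjective b
    have h (f : GenLoop N E e) : HomotopyGroup.inducedMap N p e (HomotopyGroup.proj f) =
      HomotopyGroup.proj (GenLoop.postcomp p e f) := rfl
    rw [HomotopyGroup.proj_mul_proj (Classical.arbitrary N), h, h, h,
      HomotopyGroup.proj_mul_proj (Classical.arbitrary N), GenLoop.postcomp_transAt])

theorem HomotopyGroup.inducedHom_proj (N : Type*) [DecidableEq N] [Nonempty N] {E X : Type*}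
    [TopologicalSpace E] [TopologicalSpace X] (p : C(E, X)) (e : E) (f : GenLoop N E e) :
    HomotopyGroup.inducedHom N p e (HomotopyGroup.proj f) =
      HomotopyGroup.proj (GenLoop.postcomp p e f) :=
  rfl

/-!
The whole statement rests on one fact: for a covering map `p` and a finite nonempty `N`,
post-composition with `p` is an open embedding `Ω^N (E, e) → Ω^N (X, p e)`.

Contracting the cube to its corner `0` turns the evaluation map
`Ω^N (X, p e) × I^N → X` into a homotopy starting at a constant map, so the homotopy lifting property
gives a lift `L : Ω^N (X, p e) × I^N → E` which is *jointly* continuous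
(`IsCoveringMap.exists_continuousMap_lift_genLoop`). Currying, lifting loops is continuous for the
compact-open topologies. A loop lies in the image of post-composition exactly when its lift sends the
boundary of the cube to `e`; since this boundary is compact and its lift lies in the discrete fibre
over `p e`, this is an open condition (`IsCoveringMap.isOpenEmbedding_postcomp`).

Lifting homotopies shows that `p_*` is injective and, with the above, that it is an open
embedding of the quotient spaces (`IsCoveringMap.isOpenEmbedding_inducedMap`). If `N` has at least two
elements, the boundary of the cube is path connected, so every lifted loop is constant on it and `p_*`
is also surjective (`IsCoveringMap.surjective_postcomp`).
-/

theorem Cube.isClosed_boundary (N : Type*) [Finite N] : IsClosed (Cube.boundary N) := by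
  have h : Cube.boundary N = ⋃ i, {y : N → I | y i = 0 ∨ y i = 1} := by
    ext y
    simp [Cube.boundary]
  rw [h]
  refine isClosed_iUnion_of_finite fun i => ?_
  exact (isClosed_eq (continuous_apply i) continuous_const).union
    (isClosed_eq (continuous_apply i) continuous_const)

theorem Cube.zero_mem_boundary (N : Type*) [Nonempty N] : (0 : N → I) ∈ Cube.boundary N :=
  ⟨Classical.arbitrary N, Or.inl rfl⟩

namespace IsCoveringMap

variable {N E X : Type*} [TopologicalSpace E] [TopologicalSpace X] {p : C(E, X)}

/-- Loops based at `p e` lift along a covering map, starting from `e` at the corner `0` of the cube,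
in such a way that the lift is jointly continuous in the loop and the point of the cube. -/
theorem exists_continuousMap_lift_genLoop [Nonempty N] (hp : IsCoveringMap p) (e : E) :
    ∃ L : C(GenLoop N X (p e) × (N → I), E),
      (∀ f y, p (L (f, y)) = f y) ∧ ∀ f, L (f, 0) = e := by
  let H : C(I × (GenLoop N X (p e) × (N → I)), X) :=
    ⟨fun z => z.2.1 fun j => z.1 * z.2.2 j, by fun_prop⟩
  have H_zero (z) : H (0, z) = p (ContinuousMap.const _ e z) := by
    refine Eq.trans (congrArg z.1 (funext fun j => zero_mul (z.2 j))) ?_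
    exact z.1.2 _ (Cube.zero_mem_boundary N)
  have lifts (t z) : p (hp.liftHomotopy H (.const _ e) H_zero (t, z)) = H (t, z) :=
    congrFun (hp.liftHomotopy_lifts H (.const _ e) H_zero) (t, z)
  refine ⟨(hp.liftHomotopy H (.const _ e) H_zero).comp ⟨fun z => (1, z), by fun_prop⟩,
    fun f y => (lifts 1 (f, y)).trans ?_, fun f => ?_⟩
  · exact congrArg f (funext fun j => one_mul (y j))
  · -- The track of the corner `0` is constant in `X`, hence constant in `E`.
    refine Eq.trans ?_ (hp.liftHomotopy_zero H (.const _ e) H_zero (f, 0))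
    refine hp.const_of_comp (g := fun t => hp.liftHomotopy H (.const _ e) H_zero (t, (f, 0)))
      (by fun_prop) (fun s t => ?_) 1 0
    rw [lifts, lifts]
    exact congrArg f (funext fun j => (mul_zero s).trans (mul_zero t).symm)

theorem injective_postcomp [Nonempty N] (hp : IsCoveringMap p) (e : E) :
    Function.Injective (GenLoop.postcomp (N := N) p e) := by
  intro f g h
  refine DFunLike.coe_injective (hp.eq_of_comp_eq (map_continuous f.1) (map_continuous g.1)
    (congrArg (fun k : GenLoop N X (p e) => (k : (N → I) → X)) h) 0 ?_)
  exact (f.2 _ (Cube.zero_mem_boundary N)).trans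
    (g.2 _ (Cube.zero_mem_boundary N)).symm

theorem isOpenEmbedding_postcomp [Finite N] [Nonempty N] (hp : IsCoveringMap p) (e : E) :
    Topology.IsOpenEmbedding (GenLoop.postcomp (N := N) p e) := by
  obtain ⟨L, hL, hL0⟩ := hp.exists_continuousMap_lift_genLoop (N := N) e
  obtain ⟨V, hV, heV, hpV⟩ := hp.isLocalHomeomorph.isLocallyInjective e
  refine .of_continuous_injective_isOpenMap
    (((ContinuousMap.continuous_postcomp p).comp continuous_subtype_val).subtype_mk _)
    (hp.injective_postcomp e) ?_
  rintro _ ⟨U, hU, rfl⟩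
  -- A lifted loop that maps the boundary into `V`, where `p` is injective, maps it to `e`.
  have h : GenLoop.postcomp (N := N) p e '' (Subtype.val ⁻¹' U) =
      L.curry ⁻¹' (U ∩ {g | Set.MapsTo g (Cube.boundary N) V}) := by
    ext f
    constructor
    · rintro ⟨g, hg, rfl⟩
      have h : L.curry (GenLoop.postcomp p e g) = g.1 :=
        DFunLike.coe_injective (hp.eq_of_comp_eq (map_continuous _) (map_continuous g.1)
          (funext fun y => hL (GenLoop.postcomp p e g) y) 0
          ((hL0 _).trans (g.2 _ (Cube.zero_mem_boundary N)).symm))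
      rw [Set.mem_preimage, h]
      exact ⟨hg, fun y hy => (g.2 y hy).symm ▸ heV⟩
    · rintro ⟨hfU, hfV⟩
      exact ⟨⟨L.curry f, fun y hy => hpV (hfV hy) heV ((hL f y).trans (f.2 y hy))⟩, hfU,
        GenLoop.ext _ _ fun y => hL f y⟩
  rw [h]
  exact (hU.inter (ContinuousMap.isOpen_setOfPred_mapsTo
    (Cube.isClosed_boundary N).isCompact hV)).preimage (map_continuous _)

theorem surjective_postcomp [Nontrivial N] (hp : IsCoveringMap p) (e : E) :
    Function.Surjective (GenLoop.postcomp (N := N) p e) := by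
  classical
  intro f
  obtain ⟨L, hL, hL0⟩ := hp.exists_continuousMap_lift_genLoop (N := N) e
  have const_of_mem (γ : I → N → I) (hγ : Continuous γ) (h : ∀ t, γ t ∈ Cube.boundary N) :
      L (f, γ 1) = L (f, γ 0) :=
    hp.const_of_comp (g := fun t => L (f, γ t)) (by fun_prop)
      (fun s t => by rw [hL, hL]; exact (f.2 _ (h s)).trans (f.2 _ (h t)).symm) 1 0
  -- A face through the corner `0` is joined to it by rescaling.
  have of_zero (y : N → I) (i : N) (hi : y i = 0) : L (f, y) = e := by
    have h := const_of_mem (fun t j => t * y j) (by fun_prop) fun t => ⟨i, Or.inl (by simp [hi])⟩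
    simp only [one_mul, zero_mul] at h
    exact h.trans (hL0 f)
  refine ⟨⟨L.curry f, ?_⟩, GenLoop.ext _ _ fun y => hL f y⟩
  rintro y ⟨i, hi | hi⟩
  · exact of_zero y i hi
  · -- On an opposite face, push a second coordinate to `0` without leaving the face.
    obtain ⟨j, hj⟩ := exists_ne i
    have h := const_of_mem (fun t => Function.update y j (t * y j)) (by fun_prop)
      fun t => ⟨i, Or.inr (by simp [hj.symm, hi])⟩
    simp only [one_mul, zero_mul, Function.update_eq_self] at h
    exact h.trans (of_zero _ j (by simp))

theorem injective_inducedMap [Nonempty N] (hp : IsCoveringMap p) (e : E) :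
    Function.Injective (HomotopyGroup.inducedMap N p e) := by
  intro a b h
  obtain ⟨f, rfl⟩ := HomotopyGroup.proj_surjective a
  obtain ⟨g, rfl⟩ := HomotopyGroup.proj_surjective b
  have h0 := Cube.zero_mem_boundary N
  exact Quotient.sound ((hp.homotopicRel_iff_comp
    ⟨0, h0, (f.2 _ h0).trans (g.2 _ h0).symm⟩).2 (Quotient.exact h))

/-- The end of a lifted homotopy relative to the boundary is again a loop, so the image of
post-composition is saturated for the homotopy relation. -/
theorem mem_range_postcomp_of_homotopic [Nonempty N] (hp : IsCoveringMap p) {e : E}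
    {g : GenLoop N E e} {f : GenLoop N X (p e)}
    (h : GenLoop.Homotopic (GenLoop.postcomp p e g) f) :
    f ∈ Set.range (GenLoop.postcomp (N := N) p e) := by
  obtain ⟨F⟩ := h
  have F_zero (y) : F (0, y) = p (g.1 y) := F.apply_zero y
  have lifts (t y) : p (hp.liftHomotopy F.toContinuousMap g.1 F_zero (t, y)) = F (t, y) :=
    congrFun (hp.liftHomotopy_lifts F.toContinuousMap g.1 F_zero) (t, y)
  refine ⟨⟨(hp.liftHomotopy F.toContinuousMap g.1 F_zero).curry 1, fun y hy => ?_⟩,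
    GenLoop.ext _ _ fun y => (lifts 1 y).trans (F.apply_one y)⟩
  refine Eq.trans ?_ ((hp.liftHomotopy_zero F.toContinuousMap g.1 F_zero y).trans (g.2 y hy))
  refine hp.const_of_comp (g := fun t => hp.liftHomotopy F.toContinuousMap g.1 F_zero (t, y))
    (by fun_prop) (fun s t => ?_) 1 0
  rw [lifts, lifts]
  exact (F.eq_fst s hy).trans (F.eq_fst t hy).symm

theorem isOpenEmbedding_inducedMap [Finite N] [Nonempty N] (hp : IsCoveringMap p) (e : E) :
    Topology.IsOpenEmbedding (HomotopyGroup.inducedMap N p e) := by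
  have hpost := hp.isOpenEmbedding_postcomp (N := N) e
  refine .of_continuous_injective_isOpenMap ?_ (hp.injective_inducedMap e) fun U hU => ?_
  · rw [HomotopyGroup.isQuotientMap_proj.continuous_iff]
    exact HomotopyGroup.isQuotientMap_proj.continuous.comp hpost.continuous
  · rw [← HomotopyGroup.isQuotientMap_proj.isOpen_preimage]
    have h : HomotopyGroup.proj ⁻¹' (HomotopyGroup.inducedMap N p e '' U) =
        GenLoop.postcomp p e '' (HomotopyGroup.proj ⁻¹' U) := by
      ext f
      constructor
      · rintro ⟨a, ha, hf⟩
        obtain ⟨g, rfl⟩ := HomotopyGroup.proj_surjective a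
        obtain ⟨g', rfl⟩ := hp.mem_range_postcomp_of_homotopic (Quotient.exact hf)
        refine ⟨g', ?_, rfl⟩
        have hg : HomotopyGroup.proj g = HomotopyGroup.proj g' := hp.injective_inducedMap e hf
        exact Set.mem_preimage.2 (hg ▸ ha)
      · rintro ⟨g, hg, rfl⟩
        exact ⟨HomotopyGroup.proj g, hg, rfl⟩
    rw [h]
    exact hpost.isOpenMap _ (hU.preimage HomotopyGroup.isQuotientMap_proj.continuous)

end IsCoveringMap

theorem corollary3p7 {E X : Type*} [TopologicalSpace E] [TopologicalSpace X]
    (p : C(E, X)) (hp : IsCoveringMap p) (e : E) :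
    (∀ (n : ℕ) [NeZero n], 2 ≤ n →
      ∃ φ : HomotopyGroup.Pi n E e ≃ₜ* HomotopyGroup.Pi n X (p e),
        ∀ a, φ a = HomotopyGroup.inducedHom (Fin n) p e a) ∧
    Topology.IsEmbedding (HomotopyGroup.inducedHom (Fin 1) p e) := by
  refine ⟨fun n _ hn => ?_, (hp.isOpenEmbedding_inducedMap (N := Fin 1) e).isEmbedding⟩
  have : Nontrivial (Fin n) := Fin.nontrivial_iff_two_le.2 hn
  have hopen := hp.isOpenEmbedding_inducedMap (N := Fin n) e
  have hsurj : Function.Surjective (HomotopyGroup.inducedMap (Fin n) p e) := fun b => by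
    obtain ⟨f, rfl⟩ := HomotopyGroup.proj_surjective b
    obtain ⟨g, rfl⟩ := hp.surjective_postcomp e f
    exact ⟨HomotopyGroup.proj g, rfl⟩
  let φ := MulEquiv.ofBijective (HomotopyGroup.inducedHom (Fin n) p e) ⟨hopen.injective, hsurj⟩
  let ψ := hopen.isEmbedding.toHomeomorphOfSurjective hsurj
  exact ⟨{ φ with
      continuous_toFun := hopen.continuous
      continuous_invFun := ψ.symm.continuous.congr fun b =>
        hopen.injective ((ψ.apply_symm_apply b).trans (φ.apply_symm_apply b).symm) },
    fun _ => rfl⟩
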